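/- Let $G=(S,T,E)$ be a finite bipartite graph with vertex set $V=S\cup T$ ($S$ and $T$ disjoint, every edge joining $S$ to $T$). For a matching $M$ of $G$ let $V(M)$ be the set of vertices covered by $M$, and let $B(M)=V(M)\,\Delta\,S$ (symmetric difference). Let $M$ be a uniformly random element of the set of all matchings of $G$ (including the empty matching). Then the random set $B(M)\subseteq V$ is negatively associated, in the following sense. An event is a family $\mathcal{A}\subseteq 2^V$; it is increasing (decreasing) if it is closed under taking supersets (subsets) in $V$, and it depends only on $V_0\subseteq V$ if $A\in\mathcal{A}$ and $A\cap V_0=C\cap V_0$ imply $C\in\mathcal{A}$, for all $A,C\subseteq V$. Let $\mathcal{A},\mathcal{B}\subseteq 2^V$ be events depending only on $V_1$ and $V_2$ respectively, where $V_1,V_2\subseteq V$ are disjoint. If $\mathcal{A}$ and $\mathcal{B}$ are both increasing or both decreasing, then \[\mathbb{P}(B(M)\in\mathcal{A}\cap\mathcal{B})\le\mathbb{P}(B(M)\in\mathcal{A})\,\mathbb{P}(B(M)\in\mathcal{B}).\] If one of $\mathcal{A},\mathcal{B}$ is increasing and the other is decreasing, then \[\mathbb{P}(B(M)\in\mathcal{A}\cap\mathcal{B})\ge\mathbb{P}(B(M)\in\mathcal{A})\,\mathbb{P}(B(M)\in\mathcal{B}).\]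 -/

import Mathlib

open scoped ENNReal

namespace RandomMatching

variable {V : Type*}

/-- The matchings of `G`, the empty matching included. `Subgraph.IsMatching` requires every vertex
of the subgraph to have exactly one neighbour in it, so such a subgraph is determined by its edge
set and its vertex set is the set of vertices covered by these edges. -/
abbrev Matching (G : SimpleGraph V) : Type _ := {M : G.Subgraph // M.IsMatching}

instance (G : SimpleGraph V) : Nonempty (Matching G) :=
  ⟨⟨⊥, fun _ hv => hv.elim⟩⟩

noncomputable instance [Finite V] (G : SimpleGraph V) : Fintype (Matching G) :=
  Fintype.ofFinite _

/-- `B(M) = V(M) Δ S`, where `V(M)` is the set of vertices covered by `M`. -/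
def B {G : SimpleGraph V} (S : Set V) (M : Matching G) : Set V :=
  symmDiff M.1.verts S

/-- The law of the random set `B(M)`, for `M` a uniform random matching of `G`. -/
noncomputable def lawB [Finite V] (G : SimpleGraph V) (S : Set V) : PMF (Set V) :=
  (PMF.uniformOfFintype (Matching G)).map (B S)

/-- `ℙ(B(M) ∈ 𝒜)`, for `M` a uniform random matching of `G`. -/
noncomputable def prob [Finite V] (G : SimpleGraph V) (S : Set V) (𝒜 : Set (Set V)) : ℝ≥0∞ :=
  (lawB G S).toOuterMeasure 𝒜

/-- The event `𝒜` depends only on `V₀`. -/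
def DependsOnlyOn (𝒜 : Set (Set V)) (V₀ : Set V) : Prop :=
  ∀ A C : Set V, A ∩ V₀ = C ∩ V₀ → A ∈ 𝒜 → C ∈ 𝒜

end RandomMatching

/-! Identify a matching with the involution `m` swapping the ends of its edges. As `G` is bipartite,
`B(M)` is the preimage `m ⁻¹' S`. Take two independent uniform matchings, with preimages `X` and
`Y`. The components of their union are paths and cycles, and exchanging the two matchings on any set
of components permutes the pairs of matchings, so it preserves their joint law.

In each component `X \ Y` and `Y \ X` have at most one vertex each (`injOn_rep_diff`). Hence
toggling one component cannot move an increasing `f` on `V₁` and an increasing `g` on `V₂` strictly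
in the same direction. Over a random set of toggles, Harris makes `f`, `g` of the same matching
negatively correlated, and `f` of one, `g` of the other positively correlated (`sum_mix_mul_le`).
Averaging over pairs gives `E[fg] ≤ E[f] E[g]`; indicators and their negatives cover all the cases.
-/

namespace RandomMatching

/-! ### Harris inequality with opposed coordinates -/

open scoped Classical in
/-- A Harris-type inequality in which every coordinate either is ignored by one of the two functions
or moves them in opposite directions. -/
theorem card_mul_sum_mul_le {K : Type*} (s : Finset K) (f g : Finset K → ℝ)
    (h : ∀ k ∈ s, (∀ t, f (insert k t) = f t) ∨ (∀ t, g (insert k t) = g t) ∨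
      (∀ t, f t ≤ f (insert k t) ∧ g (insert k t) ≤ g t) ∨
      (∀ t, f (insert k t) ≤ f t ∧ g t ≤ g (insert k t))) :
    2 ^ s.card * ∑ t ∈ s.powerset, f t * g t ≤
      (∑ t ∈ s.powerset, f t) * ∑ t ∈ s.powerset, g t := by
  induction s using Finset.induction_on generalizing f g with
  | empty => simp
  | insert k s hk ih =>
    have h₀ := ih f g fun j hj => h j (Finset.mem_insert_of_mem hj)
    have h₁ := ih (fun t => f (insert k t)) (fun t => g (insert k t)) fun j hj => by
      simpa only [Finset.insert_comm k j] using
        (h j (Finset.mem_insert_of_mem hj)).imp (fun H t => H (insert k t))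
          (Or.imp (fun H t => H (insert k t))
            (Or.imp (fun H t => H (insert k t)) fun H t => H (insert k t)))
    rw [Finset.sum_powerset_insert hk, Finset.sum_powerset_insert hk,
      Finset.sum_powerset_insert hk, Finset.card_insert_of_notMem hk, pow_succ]
    -- With sums `F₀, F₁, G₀, G₁` over the two halves: `2(F₀G₀ + F₁G₁) = (F₀ + F₁)(G₀ + G₁) + (F₁ -
    -- F₀)(G₁ - G₀)`.
    have key : ((∑ t ∈ s.powerset, f (insert k t)) - ∑ t ∈ s.powerset, f t) *
        ((∑ t ∈ s.powerset, g (insert k t)) - ∑ t ∈ s.powerset, g t) ≤ 0 := by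
      rcases h k (Finset.mem_insert_self k s) with H | H | H | H
      · simp [H]
      · simp [H]
      · exact mul_nonpos_of_nonneg_of_nonpos
          (sub_nonneg.2 (Finset.sum_le_sum fun t _ => (H t).1))
          (sub_nonpos.2 (Finset.sum_le_sum fun t _ => (H t).2))
      · exact mul_nonpos_of_nonpos_of_nonneg
          (sub_nonpos.2 (Finset.sum_le_sum fun t _ => (H t).1))
          (sub_nonneg.2 (Finset.sum_le_sum fun t _ => (H t).2))
    nlinarith

/-! ### Exchanging two sets fibre by fibre -/

variable {V K : Type*}

/-- The set that agrees with `Y` on the fibres of `c` over `t`, and with `X` elsewhere. -/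
def mix (c : V → K) (t : Finset K) (X Y : Set V) : Set V :=
  {v | (c v ∈ t → v ∈ Y) ∧ (c v ∉ t → v ∈ X)}

theorem mem_mix_of_mem {c : V → K} {t : Finset K} {X Y : Set V} {v : V} (h : c v ∈ t) :
    v ∈ mix c t X Y ↔ v ∈ Y := by
  simp [mix, h]

theorem mem_mix_of_notMem {c : V → K} {t : Finset K} {X Y : Set V} {v : V} (h : c v ∉ t) :
    v ∈ mix c t X Y ↔ v ∈ X := by
  simp [mix, h]

theorem mix_compl [Fintype K] [DecidableEq K] (c : V → K) (t : Finset K) (X Y : Set V) :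
    mix c tᶜ X Y = mix c t Y X := by
  ext v
  simp only [mix, Finset.mem_compl, Set.mem_ofPred_eq, not_not]
  exact and_comm

/-- Real functions on sets that are increasing and depend only on `V₀`. -/
def MonoOn (f : Set V → ℝ) (V₀ : Set V) : Prop :=
  ∀ A C : Set V, A ∩ V₀ ⊆ C ∩ V₀ → f A ≤ f C

theorem mix_inter_subset [DecidableEq K] (c : V → K) (k : K) (t : Finset K) {X Y V₀ : Set V}
    (h : ∀ v ∈ V₀, c v = k → v ∈ X → v ∈ Y) :
    mix c t X Y ∩ V₀ ⊆ mix c (insert k t) X Y ∩ V₀ := by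
  rintro v ⟨hv, hv₀⟩
  refine ⟨?_, hv₀⟩
  by_cases ht : c v ∈ t
  · rw [mem_mix_of_mem ht] at hv
    rwa [mem_mix_of_mem (Finset.mem_insert_of_mem ht)]
  · rw [mem_mix_of_notMem ht] at hv
    by_cases hk : c v = k
    · rw [mem_mix_of_mem (by simp [hk])]
      exact h v hv₀ hk hv
    · rwa [mem_mix_of_notMem (by simp [hk, ht])]

theorem inter_subset_mix [DecidableEq K] (c : V → K) (k : K) (t : Finset K) {X Y V₀ : Set V}
    (h : ∀ v ∈ V₀, c v = k → v ∈ Y → v ∈ X) :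
    mix c (insert k t) X Y ∩ V₀ ⊆ mix c t X Y ∩ V₀ := by
  rintro v ⟨hv, hv₀⟩
  refine ⟨?_, hv₀⟩
  by_cases ht : c v ∈ t
  · rw [mem_mix_of_mem (Finset.mem_insert_of_mem ht)] at hv
    rwa [mem_mix_of_mem ht]
  · rw [mem_mix_of_notMem ht]
    by_cases hk : c v = k
    · rw [mem_mix_of_mem (by simp [hk])] at hv
      exact h v hv₀ hk hv
    · rwa [mem_mix_of_notMem (by simp [hk, ht])] at hv

theorem MonoOn.map_mix_insert_eq [DecidableEq K] {f : Set V → ℝ} {V₀ : Set V} (hf : MonoOn f V₀)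
    {c : V → K} {k : K} {t : Finset K} {X Y : Set V}
    (h : ∀ v ∈ V₀, c v = k → (v ∈ X ↔ v ∈ Y)) :
    f (mix c (insert k t) X Y) = f (mix c t X Y) :=
  le_antisymm (hf _ _ (inter_subset_mix c k t fun v hv hk => (h v hv hk).2))
    (hf _ _ (mix_inter_subset c k t fun v hv hk => (h v hv hk).1))

/-- A fibre has at most one vertex of `X \ Y` and one of `Y \ X`. If both `V₁` and `V₂` see a
difference, disjointness gives each of them exactly one of these vertices. -/
theorem fibre_cases {c : V → K} {X Y V₁ V₂ : Set V}
    (hdisj : Disjoint V₁ V₂) (hX : Set.InjOn c (X \ Y)) (hY : Set.InjOn c (Y \ X)) (k : K) :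
    (∀ v ∈ V₁, c v = k → (v ∈ X ↔ v ∈ Y)) ∨ (∀ v ∈ V₂, c v = k → (v ∈ X ↔ v ∈ Y)) ∨
    ((∀ v ∈ V₁, c v = k → v ∈ X → v ∈ Y) ∧ (∀ v ∈ V₂, c v = k → v ∈ Y → v ∈ X)) ∨
    ((∀ v ∈ V₁, c v = k → v ∈ Y → v ∈ X) ∧ (∀ v ∈ V₂, c v = k → v ∈ X → v ∈ Y)) := by
  by_cases h₁ : ∀ v ∈ V₁, c v = k → (v ∈ X ↔ v ∈ Y)
  · exact Or.inl h₁
  by_cases h₂ : ∀ v ∈ V₂, c v = k → (v ∈ X ↔ v ∈ Y)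
  · exact Or.inr <| Or.inl h₂
  push Not at h₁ h₂
  obtain ⟨a, ha, hak, hab⟩ := h₁
  obtain ⟨b, hb, hbk, hbb⟩ := h₂
  have hne : ∀ v ∈ V₁, ∀ w ∈ V₂, v ≠ w := fun v hv w hw e =>
    Set.disjoint_left.1 hdisj hv (e ▸ hw)
  have hXne : ∀ v ∈ V₁, ∀ w ∈ V₂, c v = k → c w = k → v ∈ X \ Y → w ∈ X \ Y → False :=
    fun v hv w hw hvk hwk h h' => hne v hv w hw (hX h h' (hvk.trans hwk.symm))
  have hYne : ∀ v ∈ V₁, ∀ w ∈ V₂, c v = k → c w = k → v ∈ Y \ X → w ∈ Y \ X → False :=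
    fun v hv w hw hvk hwk h h' => hne v hv w hw (hY h h' (hvk.trans hwk.symm))
  rcases hab with ⟨haX, haY⟩ | ⟨haX, haY⟩ <;> rcases hbb with ⟨hbX, hbY⟩ | ⟨hbX, hbY⟩
  · exact (hXne a ha b hb hak hbk ⟨haX, haY⟩ ⟨hbX, hbY⟩).elim
  · refine Or.inr <| Or.inr <| Or.inr
      ⟨fun v hv hk hvY => ?_, fun v hv hk hvX => ?_⟩
    · by_contra hvX
      exact hYne v hv b hb hk hbk ⟨hvY, hvX⟩ ⟨hbY, hbX⟩
    · by_contra hvY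
      exact hXne a ha v hv hak hk ⟨haX, haY⟩ ⟨hvX, hvY⟩
  · refine Or.inr <| Or.inr <| Or.inl
      ⟨fun v hv hk hvX => ?_, fun v hv hk hvY => ?_⟩
    · by_contra hvY
      exact hXne v hv b hb hk hbk ⟨hvX, hvY⟩ ⟨hbX, hbY⟩
    · by_contra hvX
      exact hYne a ha v hv hak hk ⟨haY, haX⟩ ⟨hvY, hvX⟩
  · exact (hYne a ha b hb hak hbk ⟨haY, haX⟩ ⟨hbY, hbX⟩).elim

/-- Exchanging `X` and `Y` on random fibres of `c`, two functions of the resulting set are less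
correlated than a function of that set and a function of its counterpart. -/
theorem sum_mix_mul_le [Fintype K] {c : V → K} {X Y V₁ V₂ : Set V}
    (hdisj : Disjoint V₁ V₂) (hX : Set.InjOn c (X \ Y)) (hY : Set.InjOn c (Y \ X))
    {f g : Set V → ℝ} (hf : MonoOn f V₁) (hg : MonoOn g V₂) :
    ∑ t : Finset K, f (mix c t X Y) * g (mix c t X Y) ≤
      ∑ t : Finset K, f (mix c t X Y) * g (mix c t Y X) := by
  classical
  have h₁ := card_mul_sum_mul_le Finset.univ (fun t => f (mix c t X Y)) (fun t => g (mix c t X Y))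
    fun k _ => by
      rcases fibre_cases hdisj hX hY k with H | H | ⟨H, H'⟩ | ⟨H, H'⟩
      · exact Or.inl fun t => hf.map_mix_insert_eq H
      · exact Or.inr <| Or.inl fun t => hg.map_mix_insert_eq H
      · exact Or.inr <| Or.inr <| Or.inl fun t =>
          ⟨hf _ _ (mix_inter_subset c k t H), hg _ _ (inter_subset_mix c k t H')⟩
      · exact Or.inr <| Or.inr <| Or.inr fun t =>
          ⟨hf _ _ (inter_subset_mix c k t H), hg _ _ (mix_inter_subset c k t H')⟩
  -- Reversing the roles of `X` and `Y` in `g` reverses its direction, so the sign restores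
  -- opposition.
  have h₂ := card_mul_sum_mul_le Finset.univ (fun t => f (mix c t X Y)) (fun t => -g (mix c t Y X))
    fun k _ => by
      rcases fibre_cases hdisj hX hY k with H | H | ⟨H, H'⟩ | ⟨H, H'⟩
      · exact Or.inl fun t => hf.map_mix_insert_eq H
      · exact Or.inr <| Or.inl fun t =>
          congrArg Neg.neg (hg.map_mix_insert_eq fun v hv hk => (H v hv hk).symm)
      · exact Or.inr <| Or.inr <| Or.inl fun t =>
          ⟨hf _ _ (mix_inter_subset c k t H), neg_le_neg (hg _ _ (mix_inter_subset c k t H'))⟩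
      · exact Or.inr <| Or.inr <| Or.inr fun t =>
          ⟨hf _ _ (inter_subset_mix c k t H), neg_le_neg (hg _ _ (inter_subset_mix c k t H'))⟩
  have hcompl : ∑ t : Finset K, g (mix c t Y X) = ∑ t : Finset K, g (mix c t X Y) := by
    rw [Finset.sum_congr rfl fun t _ => congrArg g (mix_compl c t X Y).symm]
    exact Equiv.sum_comp (Function.Involutive.toPerm compl compl_involutive)
      fun t : Finset K => g (mix c t X Y)
  simp only [Finset.powerset_univ, mul_neg, Finset.sum_neg_distrib] at h₁ h₂
  rw [hcompl] at h₂
  have hpos : (0 : ℝ) < 2 ^ (Finset.univ : Finset K).card := by positivity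
  exact le_of_mul_le_mul_left (by linarith) hpos

/-! ### Matchings as involutions -/

/-- The involutions that move vertices only along edges of `G`. They correspond to matchings. -/
abbrev Flip (G : SimpleGraph V) : Type _ :=
  {m : V → V // Function.Involutive m ∧ ∀ v, m v ≠ v → G.Adj v (m v)}

open scoped Classical in
/-- The map exchanging the endpoints of each edge of a matching. -/
noncomputable def partner {G : SimpleGraph V} (M : Matching G) (v : V) : V :=
  if h : v ∈ M.1.verts then (M.2 h).choose else v

theorem adj_partner {G : SimpleGraph V} (M : Matching G) {v : V} (h : v ∈ M.1.verts) :
    M.1.Adj v (partner M v) := by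
  rw [partner, dif_pos h]
  exact (M.2 h).choose_spec.1

theorem partner_of_notMem {G : SimpleGraph V} (M : Matching G) {v : V} (h : v ∉ M.1.verts) :
    partner M v = v := dif_neg h

theorem partner_eq_of_adj {G : SimpleGraph V} (M : Matching G) {v w : V} (h : M.1.Adj v w) :
    partner M v = w :=
  (M.2 (M.1.edge_vert h)).unique (adj_partner M (M.1.edge_vert h)) h

theorem partner_ne_iff {G : SimpleGraph V} (M : Matching G) {v : V} :
    partner M v ≠ v ↔ v ∈ M.1.verts := by
  refine ⟨fun h => by_contra fun h' => h (partner_of_notMem M h'), fun h => ?_⟩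
  exact (adj_partner M h).adj_sub.ne'

/-- A matching corresponds to the involution exchanging the endpoints of its edges. -/
noncomputable def matchingEquivFlip (G : SimpleGraph V) : Matching G ≃ Flip G where
  toFun M := ⟨partner M, fun v => by
      by_cases h : v ∈ M.1.verts
      · exact partner_eq_of_adj M (adj_partner M h).symm
      · rw [partner_of_notMem M h, partner_of_notMem M h],
    fun v h => (adj_partner M ((partner_ne_iff M).1 h)).adj_sub⟩
  invFun m := ⟨{
      verts := {v | m.1 v ≠ v}
      Adj := fun v w => m.1 v = w ∧ w ≠ v
      adj_sub := by
        rintro v w ⟨rfl, h⟩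
        exact m.2.2 v h
      edge_vert := by
        rintro v w ⟨rfl, h⟩
        exact h
      symm := ⟨by
        rintro v w ⟨rfl, h⟩
        exact ⟨m.2.1 v, h.symm⟩⟩ },
    fun v hv => ⟨m.1 v, ⟨rfl, hv⟩, fun w hw => hw.1.symm⟩⟩
  left_inv M := by
    apply Subtype.ext
    ext v w
    · exact partner_ne_iff M
    · refine ⟨?_, fun h => ⟨partner_eq_of_adj M h, h.adj_sub.ne'⟩⟩
      rintro ⟨rfl, h⟩
      exact adj_partner M ((partner_ne_iff M).1 h)
  right_inv m := by
    apply Subtype.ext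
    funext v
    by_cases h : m.1 v = v
    · exact (partner_of_notMem _ (by simpa using h)).trans h.symm
    · exact partner_eq_of_adj _ ⟨rfl, h⟩

theorem Flip.mem_iff_of_ne {G : SimpleGraph V} {S T : Set V} (hG : G.IsBipartiteWith S T)
    (m : Flip G) {v : V} (h : m.1 v ≠ v) : m.1 v ∈ S ↔ v ∉ S := by
  have hadj := m.2.2 v h
  rcases hG.mem_of_adj hadj with ⟨h₁, h₂⟩ | ⟨h₁, h₂⟩
  · exact iff_of_false (Set.disjoint_right.1 hG.disjoint h₂) (not_not.2 h₁)
  · exact iff_of_true h₂ (Set.disjoint_right.1 hG.disjoint h₁)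

theorem B_eq_preimage {G : SimpleGraph V} {S T : Set V} (hG : G.IsBipartiteWith S T)
    (M : Matching G) : B S M = (matchingEquivFlip G M).1 ⁻¹' S := by
  ext v
  have hp : (matchingEquivFlip G M).1 v = partner M v := rfl
  rw [B, Set.mem_symmDiff, Set.mem_preimage]
  by_cases h : v ∈ M.1.verts
  · rw [Flip.mem_iff_of_ne hG _ (by rw [hp]; exact (partner_ne_iff M).2 h)]
    simp [h]
  · rw [hp, partner_of_notMem M h]
    simp [h]

/-! ### Splicing two matchings along components -/

/-- The union of the edge sets of two matchings. -/
def unionGraph (m₁ m₂ : V → V) : SimpleGraph V :=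
  SimpleGraph.fromRel fun v w => m₁ v = w ∨ m₂ v = w

theorem unionGraph_adj {m₁ m₂ : V → V} (h₁ : Function.Involutive m₁)
    (h₂ : Function.Involutive m₂) {v w : V} :
    (unionGraph m₁ m₂).Adj v w ↔ v ≠ w ∧ (m₁ v = w ∨ m₂ v = w) := by
  rw [unionGraph, SimpleGraph.fromRel_adj]
  have e₁ : m₁ w = v ↔ m₁ v = w := by rw [h₁.eq_iff, eq_comm]
  have e₂ : m₂ w = v ↔ m₂ v = w := by rw [h₂.eq_iff, eq_comm]
  grind

/-- A representative of the component of `v` in the union of two matchings. -/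
noncomputable def rep (m₁ m₂ : V → V) (v : V) : V :=
  ((unionGraph m₁ m₂).connectedComponentMk v).out

theorem rep_eq_iff {m₁ m₂ : V → V} {v w : V} :
    rep m₁ m₂ v = rep m₁ m₂ w ↔ (unionGraph m₁ m₂).connectedComponentMk v =
      (unionGraph m₁ m₂).connectedComponentMk w :=
  (Function.LeftInverse.injective Quot.out_eq).eq_iff

theorem mk_left_eq (m₁ m₂ : V → V) (v : V) :
    (unionGraph m₁ m₂).connectedComponentMk (m₁ v) =
      (unionGraph m₁ m₂).connectedComponentMk v := by
  by_cases h : m₁ v = v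
  · rw [h]
  · refine SimpleGraph.ConnectedComponent.connectedComponentMk_eq_of_adj ?_
    exact (SimpleGraph.fromRel_adj _ _ _).2 ⟨h, Or.inr (Or.inl rfl)⟩

theorem unionGraph_comm (m₁ m₂ : V → V) : unionGraph m₁ m₂ = unionGraph m₂ m₁ := by
  simp only [unionGraph, or_comm]

theorem mk_right_eq (m₁ m₂ : V → V) (v : V) :
    (unionGraph m₁ m₂).connectedComponentMk (m₂ v) =
      (unionGraph m₁ m₂).connectedComponentMk v := by
  rw [unionGraph_comm]
  exact mk_left_eq m₂ m₁ v

open scoped Classical in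
/-- The map that follows `m₂` on the components represented in `t`, and `m₁` elsewhere. -/
noncomputable def splice (t : Finset V) (m₁ m₂ : V → V) (v : V) : V :=
  if rep m₁ m₂ v ∈ t then m₂ v else m₁ v

theorem splice_involutive (t : Finset V) {m₁ m₂ : V → V} (h₁ : Function.Involutive m₁)
    (h₂ : Function.Involutive m₂) : Function.Involutive (splice t m₁ m₂) := by
  intro v
  have e₁ : rep m₁ m₂ (m₁ v) = rep m₁ m₂ v := rep_eq_iff.2 (mk_left_eq _ _ _)
  have e₂ : rep m₁ m₂ (m₂ v) = rep m₁ m₂ v := rep_eq_iff.2 (mk_right_eq _ _ _)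
  by_cases h : rep m₁ m₂ v ∈ t <;> simp [splice, h, e₁, e₂, h₁ v, h₂ v]

theorem rep_comm (m₁ m₂ : V → V) : rep m₁ m₂ = rep m₂ m₁ := by
  funext v
  rw [rep, rep, unionGraph_comm]

theorem unionGraph_splice (t : Finset V) (m₁ m₂ : V → V) :
    unionGraph (splice t m₁ m₂) (splice t m₂ m₁) = unionGraph m₁ m₂ := by
  unfold unionGraph
  congr 1
  funext v w
  rw [splice, splice, rep_comm m₂ m₁]
  split_ifs
  · exact propext or_comm
  · rfl

/-- Splicing leaves the union graph unchanged, hence also the representatives, so the second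
exchange undoes the first. -/
theorem splice_splice (t : Finset V) (m₁ m₂ : V → V) :
    splice t (splice t m₁ m₂) (splice t m₂ m₁) = m₁ := by
  funext v
  have hrep : rep (splice t m₁ m₂) (splice t m₂ m₁) v = rep m₁ m₂ v := by
    rw [rep, rep, unionGraph_splice]
  rw [splice, hrep, splice, splice, rep_comm m₂ m₁]
  split_ifs <;> rfl

theorem splice_preimage (t : Finset V) (m₁ m₂ : V → V) (S : Set V) :
    splice t m₁ m₂ ⁻¹' S = mix (rep m₁ m₂) t (m₁ ⁻¹' S) (m₂ ⁻¹' S) := by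
  ext v
  by_cases h : rep m₁ m₂ v ∈ t <;> simp [splice, mix, h]

/-- Splicing two matchings along components of their union. -/
noncomputable def Flip.splice {G : SimpleGraph V} (t : Finset V) (m₁ m₂ : Flip G) : Flip G :=
  ⟨RandomMatching.splice t m₁.1 m₂.1, splice_involutive t m₁.2.1 m₂.2.1, fun v h => by
    unfold RandomMatching.splice at h ⊢
    split_ifs at h ⊢
    · exact m₂.2.2 v h
    · exact m₁.2.2 v h⟩

/-- Exchanging two matchings on the components represented in `t` is an involution of pairs. -/
noncomputable def spliceEquiv (G : SimpleGraph V) (t : Finset V) :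
    Flip G × Flip G ≃ Flip G × Flip G :=
  Function.Involutive.toPerm (fun p => (p.1.splice t p.2, p.2.splice t p.1)) fun p =>
    Prod.ext (Subtype.ext (splice_splice t p.1.1 p.2.1)) (Subtype.ext (splice_splice t p.2.1 p.1.1))

/-! ### Differences within one component -/

/-- A component of a graph of maximum degree two has at most two vertices of degree at most one. -/
theorem card_deficient_le_two [Fintype V] (H : SimpleGraph V) (C : H.ConnectedComponent)
    (D : Set V) (hdeg : ∀ v, (H.neighborSet v).ncard ≤ 2)
    (hD : ∀ v ∈ D, (H.neighborSet v).ncard ≤ 1) : (D ∩ C.supp).ncard ≤ 2 := by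
  classical
  have hconn : C.toSimpleGraph.Connected := C.connected_toSimpleGraph
  have hE := hconn.card_vert_le_card_edgeSet_add_one
  have hsum := C.toSimpleGraph.sum_degrees_eq_twice_card_edges
  rw [Nat.card_eq_fintype_card, Nat.card_eq_fintype_card,
    ← SimpleGraph.edgeFinset_card] at hE
  have hle : ∀ v : C, C.toSimpleGraph.degree v ≤ (H.neighborSet v).ncard := by
    intro v
    rw [← SimpleGraph.card_neighborSet_eq_degree, ← Nat.card_eq_fintype_card,
      Nat.card_coe_set_eq, ← Set.ncard_image_of_injective _ Subtype.val_injective]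
    refine Set.ncard_le_ncard ?_ (Set.toFinite _)
    rintro _ ⟨w, hw, rfl⟩
    exact hw
  have hbound : ∀ v : C, C.toSimpleGraph.degree v + (if (v : V) ∈ D then 1 else 0) ≤ 2 := by
    intro v
    have := hle v
    split_ifs with h
    · have := hD v h
      omega
    · have := hdeg v
      omega
  have htotal := Finset.sum_le_sum fun v (_ : v ∈ Finset.univ) => hbound v
  -- The total is `2|E| + |D ∩ C| ≤ 2|C|`, while connectedness gives `|C| ≤ |E| + 1`.
  rw [Finset.sum_add_distrib, hsum, Finset.sum_const, smul_eq_mul, Finset.card_univ,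
    Finset.sum_boole] at htotal
  have hcard : (D ∩ C.supp).ncard = (Finset.univ.filter fun v : C => (v : V) ∈ D).card := by
    rw [← Set.ncard_coe_finset, ← Set.ncard_image_of_injective _ Subtype.val_injective]
    congr 1
    ext v
    simp only [Set.mem_inter_iff, Set.mem_image, Finset.coe_filter, Finset.mem_univ, true_and]
    exact ⟨fun h => ⟨⟨v, h.2⟩, h.1, rfl⟩, by rintro ⟨w, hw, rfl⟩; exact ⟨hw, w.2⟩⟩
  simp only [Nat.cast_id] at htotal
  omega

theorem ncard_preimage_inter {m : V → V} (hm : Function.Involutive m) {S C : Set V}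
    (hC : ∀ v, m v ∈ C ↔ v ∈ C) : (m ⁻¹' S ∩ C).ncard = (S ∩ C).ncard := by
  rw [← Set.ncard_image_of_injective (m ⁻¹' S ∩ C) hm.injective, hm.image_eq_preimage_symm]
  congr 1
  ext v
  simp [hC, hm v]

/-- A vertex where `X` and `Y` differ has degree at most one in the union, so a component has at
most two. Both involutions preserve the component `C`, so `X` and `Y` each meet it in `|S ∩ C|`
points, and the differences split evenly. -/
theorem injOn_rep_diff [Finite V] {G : SimpleGraph V} {S T : Set V} (hG : G.IsBipartiteWith S T)
    (m₁ m₂ : Flip G) : Set.InjOn (rep m₁.1 m₂.1) (m₁.1 ⁻¹' S \ m₂.1 ⁻¹' S) := by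
  classical
  have := Fintype.ofFinite V
  intro a ha b hb hab
  by_contra hne
  set H := unionGraph m₁.1 m₂.1
  set C := H.connectedComponentMk a
  set X := m₁.1 ⁻¹' S with hXdef
  set Y := m₂.1 ⁻¹' S with hYdef
  have hnb : ∀ v, H.neighborSet v ⊆ ({m₁.1 v, m₂.1 v} : Set V) \ {v} := by
    intro v w hw
    obtain ⟨h, h'⟩ := (unionGraph_adj m₁.2.1 m₂.2.1).1 hw
    exact ⟨h'.imp Eq.symm Eq.symm, fun e => h (Eq.symm e)⟩
  -- If both involutions move `v`, both send it to the opposite side.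
  have hfix : ∀ v ∈ symmDiff X Y, m₁.1 v = v ∨ m₂.1 v = v := by
    intro v hv
    by_contra! h
    have e₁ := Flip.mem_iff_of_ne hG m₁ h.1
    have e₂ := Flip.mem_iff_of_ne hG m₂ h.2
    rw [Set.mem_symmDiff, hXdef, hYdef, Set.mem_preimage, Set.mem_preimage] at hv
    tauto
  have hcard : (symmDiff X Y ∩ C.supp).ncard ≤ 2 := by
    refine card_deficient_le_two H C _ (fun v => ?_) fun v hv => ?_
    · exact (Set.ncard_le_ncard ((hnb v).trans Set.sdiff_subset) (Set.toFinite _)).trans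
        ((Set.ncard_insert_le _ _).trans (by rw [Set.ncard_singleton]))
    · rcases hfix v hv with h | h
      · refine (Set.ncard_le_ncard (t := {m₂.1 v}) (fun w hw => ?_) (Set.toFinite _)).trans
          (Set.ncard_singleton _).le
        have := hnb v hw
        simp only [h, Set.mem_sdiff, Set.mem_insert_iff, Set.mem_singleton_iff] at this ⊢
        tauto
      · refine (Set.ncard_le_ncard (t := {m₁.1 v}) (fun w hw => ?_) (Set.toFinite _)).trans
          (Set.ncard_singleton _).le
        have := hnb v hw
        simp only [h, Set.mem_sdiff, Set.mem_insert_iff, Set.mem_singleton_iff] at this ⊢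
        tauto
  have heq : (X ∩ C.supp).ncard = (Y ∩ C.supp).ncard := by
    rw [ncard_preimage_inter m₁.2.1, ncard_preimage_inter m₂.2.1]
    · intro v
      rw [SimpleGraph.ConnectedComponent.mem_supp_iff, SimpleGraph.ConnectedComponent.mem_supp_iff,
        mk_right_eq m₁.1 m₂.1 v]
    · intro v
      rw [SimpleGraph.ConnectedComponent.mem_supp_iff, SimpleGraph.ConnectedComponent.mem_supp_iff,
        mk_left_eq m₁.1 m₂.1 v]
  have hdiff : ((X ∩ C.supp) \ (Y ∩ C.supp)).ncard = ((Y ∩ C.supp) \ (X ∩ C.supp)).ncard := by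
    have e₁ := Set.ncard_inter_add_ncard_sdiff_eq_ncard (X ∩ C.supp) (Y ∩ C.supp) (Set.toFinite _)
    have e₂ := Set.ncard_inter_add_ncard_sdiff_eq_ncard (Y ∩ C.supp) (X ∩ C.supp) (Set.toFinite _)
    rw [Set.inter_comm (Y ∩ C.supp)] at e₂
    omega
  have hsplit : symmDiff X Y ∩ C.supp =
      ((X ∩ C.supp) \ (Y ∩ C.supp)) ∪ ((Y ∩ C.supp) \ (X ∩ C.supp)) := by
    ext v
    simp only [Set.mem_inter_iff, Set.mem_symmDiff, Set.mem_union, Set.mem_sdiff]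
    tauto
  rw [hsplit, Set.ncard_union_eq (Set.disjoint_left.2 fun v hv hv' => hv.2 hv'.1)
    (Set.toFinite _) (Set.toFinite _), ← hdiff] at hcard
  have haC : a ∈ C.supp := rfl
  have hbC : b ∈ C.supp := (rep_eq_iff.1 hab).symm
  have htwo : 1 < ((X ∩ C.supp) \ (Y ∩ C.supp)).ncard :=
    (Set.one_lt_ncard (Set.toFinite _)).2
      ⟨a, ⟨⟨ha.1, haC⟩, fun h => ha.2 h.1⟩, b, ⟨⟨hb.1, hbC⟩, fun h => hb.2 h.1⟩, hne⟩
  omega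

/-! ### Averaging over pairs of matchings -/

theorem card_mul_sum_flip_le [Fintype V] {G : SimpleGraph V} [Fintype (Flip G)] {S T : Set V}
    (hG : G.IsBipartiteWith S T) {V₁ V₂ : Set V} (hdisj : Disjoint V₁ V₂) {f g : Set V → ℝ}
    (hf : MonoOn f V₁) (hg : MonoOn g V₂) :
    Fintype.card (Flip G) * ∑ m : Flip G, f (m.1 ⁻¹' S) * g (m.1 ⁻¹' S) ≤
      (∑ m : Flip G, f (m.1 ⁻¹' S)) * ∑ m : Flip G, g (m.1 ⁻¹' S) := by
  -- For each fixed `t`, splicing only permutes the pairs. Elements of `t` that represent no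
  -- component have no effect.
  have havg : ∀ F : Flip G × Flip G → ℝ, Fintype.card (Finset V) * ∑ p, F p =
      ∑ p, ∑ t : Finset V, F (spliceEquiv G t p) := by
    intro F
    rw [Finset.sum_comm]
    simp_rw [Equiv.sum_comp]
    simp
  have hpairs : ∑ p : Flip G × Flip G, f (p.1.1 ⁻¹' S) * g (p.1.1 ⁻¹' S) ≤
      ∑ p : Flip G × Flip G, f (p.1.1 ⁻¹' S) * g (p.2.1 ⁻¹' S) := by
    refine le_of_mul_le_mul_left ?_
      (Nat.cast_pos.2 (Fintype.card_pos (α := Finset V)) : (0 : ℝ) < _)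
    rw [havg, havg]
    refine Finset.sum_le_sum fun p _ => ?_
    have e₁ : ∀ t, (spliceEquiv G t p).1.1 ⁻¹' S =
        mix (rep p.1.1 p.2.1) t (p.1.1 ⁻¹' S) (p.2.1 ⁻¹' S) :=
      fun t => splice_preimage t p.1.1 p.2.1 S
    have e₂ : ∀ t, (spliceEquiv G t p).2.1 ⁻¹' S =
        mix (rep p.1.1 p.2.1) t (p.2.1 ⁻¹' S) (p.1.1 ⁻¹' S) := fun t => by
      rw [rep_comm]
      exact splice_preimage t p.2.1 p.1.1 S
    simp_rw [e₁, e₂]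
    refine sum_mix_mul_le hdisj (injOn_rep_diff hG _ _) ?_ hf hg
    rw [rep_comm]
    exact injOn_rep_diff hG _ _
  rw [Fintype.sum_prod_type, Fintype.sum_prod_type] at hpairs
  rw [Finset.sum_mul_sum]
  simpa [Finset.mul_sum] using hpairs

theorem card_mul_sum_matching_le [Finite V] {G : SimpleGraph V} {S T : Set V}
    (hG : G.IsBipartiteWith S T) {V₁ V₂ : Set V} (hdisj : Disjoint V₁ V₂) {f g : Set V → ℝ}
    (hf : MonoOn f V₁) (hg : MonoOn g V₂) :
    Fintype.card (Matching G) * ∑ M : Matching G, f (B S M) * g (B S M) ≤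
      (∑ M : Matching G, f (B S M)) * ∑ M : Matching G, g (B S M) := by
  have := Fintype.ofFinite V
  have := Fintype.ofEquiv _ (matchingEquivFlip G)
  simp_rw [B_eq_preimage hG]
  rw [Equiv.sum_comp (matchingEquivFlip G) fun m => f (m.1 ⁻¹' S) * g (m.1 ⁻¹' S),
    Equiv.sum_comp (matchingEquivFlip G) fun m => f (m.1 ⁻¹' S),
    Equiv.sum_comp (matchingEquivFlip G) fun m => g (m.1 ⁻¹' S),
    Fintype.card_congr (matchingEquivFlip G)]
  exact card_mul_sum_flip_le hG hdisj hf hg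

/-! ### From sums of indicators to probabilities -/

open scoped Classical in
theorem prob_eq [Finite V] (G : SimpleGraph V) (S : Set V) (𝒜 : Set (Set V)) :
    prob G S 𝒜 = ENNReal.ofReal
      ((∑ M : Matching G, 𝒜.indicator 1 (B S M)) / Fintype.card (Matching G)) := by
  rw [prob, lawB, PMF.toOuterMeasure_map_apply, PMF.toOuterMeasure_uniformOfFintype_apply,
    ENNReal.ofReal_div_of_pos (Nat.cast_pos.2 Fintype.card_pos), ENNReal.ofReal_natCast]
  congr 1
  have : (∑ M : Matching G, 𝒜.indicator (1 : Set V → ℝ) (B S M)) =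
      (Fintype.card (B S ⁻¹' 𝒜 : Set (Matching G)) : ℝ) := by
    simp only [Set.indicator_apply, Pi.one_apply, Finset.sum_boole]
    rw [Fintype.card_subtype]
    rfl
  rw [this, ENNReal.ofReal_natCast]

theorem monoOn_indicator {𝒜 : Set (Set V)} {V₀ : Set V} (h : DependsOnlyOn 𝒜 V₀)
    (hup : IsUpperSet 𝒜) : MonoOn (𝒜.indicator 1) V₀ := by
  classical
  intro A C hAC
  have himp : A ∈ 𝒜 → C ∈ 𝒜 := fun hA =>
    hup Set.inter_subset_left (hup hAC (h A (A ∩ V₀) (by simp [Set.inter_assoc]) hA))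
  simp only [Set.indicator_apply, Pi.one_apply]
  split_ifs <;> first | tauto | norm_num

theorem monoOn_neg_indicator {𝒜 : Set (Set V)} {V₀ : Set V} (h : DependsOnlyOn 𝒜 V₀)
    (hlow : IsLowerSet 𝒜) : MonoOn (-𝒜.indicator 1) V₀ := by
  classical
  intro A C hAC
  have himp : C ∈ 𝒜 → A ∈ 𝒜 := fun hC =>
    h (A ∩ V₀) A (by simp [Set.inter_assoc]) (hlow (hAC.trans Set.inter_subset_left) hC)
  simp only [Pi.neg_apply, Set.indicator_apply, Pi.one_apply]
  split_ifs <;> first | tauto | norm_num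

theorem sum_indicator_nonneg [Finite V] (G : SimpleGraph V) (S : Set V) (𝒜 : Set (Set V)) :
    (0 : ℝ) ≤ ∑ M : Matching G, 𝒜.indicator 1 (B S M) :=
  Finset.sum_nonneg fun _ _ => Set.indicator_nonneg (fun _ _ => zero_le_one) _

theorem prob_mul_prob [Finite V] (G : SimpleGraph V) (S : Set V) (𝒜 ℬ : Set (Set V)) :
    prob G S 𝒜 * prob G S ℬ = ENNReal.ofReal
      ((∑ M : Matching G, 𝒜.indicator 1 (B S M)) * (∑ M : Matching G, ℬ.indicator 1 (B S M)) /
        (Fintype.card (Matching G) * Fintype.card (Matching G))) := by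
  rw [prob_eq, prob_eq, ← ENNReal.ofReal_mul
    (div_nonneg (sum_indicator_nonneg G S 𝒜) (Nat.cast_nonneg _)), div_mul_div_comm]

theorem prob_inter [Finite V] (G : SimpleGraph V) (S : Set V) (𝒜 ℬ : Set (Set V)) :
    prob G S (𝒜 ∩ ℬ) = ENNReal.ofReal
      (Fintype.card (Matching G) *
          (∑ M : Matching G, 𝒜.indicator 1 (B S M) * ℬ.indicator 1 (B S M)) /
        (Fintype.card (Matching G) * Fintype.card (Matching G))) := by
  have hne : (Fintype.card (Matching G) : ℝ) ≠ 0 := Nat.cast_ne_zero.2 Fintype.card_ne_zero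
  rw [prob_eq, mul_div_mul_left _ _ hne]
  simp_rw [Set.inter_indicator_one, Pi.mul_apply]

end RandomMatching

theorem mainTheorem4 {V : Type*} [Finite V] (G : SimpleGraph V) (S T : Set V)
    (hG : G.IsBipartiteWith S T) (hV : S ∪ T = Set.univ)
    (𝒜 ℬ : Set (Set V)) (V₁ V₂ : Set V) (hdisj : Disjoint V₁ V₂)
    (h𝒜 : RandomMatching.DependsOnlyOn 𝒜 V₁) (hℬ : RandomMatching.DependsOnlyOn ℬ V₂) :
    ((IsUpperSet 𝒜 ∧ IsUpperSet ℬ) ∨ (IsLowerSet 𝒜 ∧ IsLowerSet ℬ) →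
      RandomMatching.prob G S (𝒜 ∩ ℬ) ≤ RandomMatching.prob G S 𝒜 * RandomMatching.prob G S ℬ) ∧
    ((IsUpperSet 𝒜 ∧ IsLowerSet ℬ) ∨ (IsLowerSet 𝒜 ∧ IsUpperSet ℬ) →
      RandomMatching.prob G S 𝒜 * RandomMatching.prob G S ℬ ≤ RandomMatching.prob G S (𝒜 ∩ ℬ)) := by
  rw [RandomMatching.prob_mul_prob, RandomMatching.prob_inter]
  constructor
  · rintro (⟨h₁, h₂⟩ | ⟨h₁, h₂⟩) <;>
      refine ENNReal.ofReal_le_ofReal (div_le_div_of_nonneg_right ?_ (by positivity))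
    · exact RandomMatching.card_mul_sum_matching_le hG hdisj
        (RandomMatching.monoOn_indicator h𝒜 h₁) (RandomMatching.monoOn_indicator hℬ h₂)
    · simpa using RandomMatching.card_mul_sum_matching_le hG hdisj
        (RandomMatching.monoOn_neg_indicator h𝒜 h₁) (RandomMatching.monoOn_neg_indicator hℬ h₂)
  · rintro (⟨h₁, h₂⟩ | ⟨h₁, h₂⟩) <;>
      refine ENNReal.ofReal_le_ofReal (div_le_div_of_nonneg_right ?_ (by positivity))
    -- Exactly one function is negated, which reverses the inequality.
    · simpa using RandomMatching.card_mul_sum_matching_le hG hdisj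
        (RandomMatching.monoOn_indicator h𝒜 h₁) (RandomMatching.monoOn_neg_indicator hℬ h₂)
    · simpa using RandomMatching.card_mul_sum_matching_le hG hdisj
        (RandomMatching.monoOn_neg_indicator h𝒜 h₁) (RandomMatching.monoOn_indicator hℬ h₂)
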